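/- **Setting.** Let $\mathbb H$ be a complex separable Hilbert space. An *Orlicz function* is a convex, nondecreasing, continuous function $\varphi:[0,\infty)\to[0,\infty]$ with $\varphi(0)=0$, $\varphi(\alpha)>0$ for $\alpha>0$, and $\varphi(\alpha)\to\infty$ as $\alpha\to\infty$. Its *complementary function* is $\psi(u)=\sup\{uv-\varphi(v): v\ge 0\}\in[0,\infty]$. For a compact operator $x$ on $\mathbb H$ let $s_0(x)\ge s_1(x)\ge\dots$ be its singular values, i.e. the eigenvalues of $|x|=(x^*x)^{1/2}$ in decreasing order, repeated according to multiplicity (continued by $0$ if only finitely many are positive). For $f=\varphi$ or $f=\psi$ put $$\mathrm{Tr}(f(x))=\sum_{n\ge0} f(s_n(x))\in[0,\infty],\qquad S_f=\{x \text{ compact}: \mathrm{Tr}(f(\lambda x))<\infty\text{ for some }\lambda>0\},$$ $$\|x\|_f=\inf\{\lambda>0:\mathrm{Tr}(f(x/\lambda))\le 1\},\qquad \|x\|_\varphi^{o}=\sup\{\mathrm{Tr}(|xy|): y\text{ compact},\ \mathrm{Tr}(\psi(y))\le 1\},$$ where $\mathrm{Tr}(T)=\sum_k\langle e_k,Te_k\rangle\in[0,\infty]$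 for a positive bounded operator $T$ and any orthonormal basis $(e_k)$. Let $S_1$ be the trace class, i.e. the set of compact operators with $\sum_n s_n(x)<\infty$. **Lemma 3.1.** Let $\varphi$ be an Orlicz function with complementary function $\psi$, and let $x\in S_\varphi$, $y\in S_\psi$. Then 1. if $\|x\|_\varphi>1$, then $\mathrm{Tr}(\varphi(x))\ge\|x\|_\varphi$; 2. if $x\ne0$, then $\|x\|_\varphi>0$ and $\mathrm{Tr}\big(\varphi(x/\|x\|_\varphi)\big)\le1$; 3. if $\|x\|_\varphi\le1$, then $\mathrm{Tr}(\varphi(x))\le\|x\|_\varphi$; 4. (Hölder inequality) $\|x\|^{o}_\varphi<\infty$ and $\mathrm{Tr}(|xy|)\le\|x\|^{o}_\varphi\,\|y\|_\psi$; 5. $xy\in S_1$ and $yx\in S_1$. -/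

import Mathlib

open scoped NNReal ENNReal Topology
open Set Filter

namespace NCOrlicz

noncomputable section

/-- An Orlicz function: a convex, nondecreasing, continuous `φ : [0,∞) → [0,∞]` with `φ 0 = 0`,
`φ α > 0` for `α > 0`, and `φ α → ∞` as `α → ∞`. Infinite values are allowed. -/
structure IsOrliczFunction (φ : ℝ≥0 → ℝ≥0∞) : Prop where
  convex : ConvexOn ℝ≥0 univ φ
  mono : Monotone φ
  continuous : Continuous φ
  map_zero : φ 0 = 0
  pos : ∀ α, 0 < α → 0 < φ α
  tendsto_top : Tendsto φ atTop (𝓝 ∞)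

/-- The complementary function `ψ u = sup {u v - φ v : v ≥ 0}`. The subtraction of `ℝ≥0∞` is
truncated at `0`, which does not change the supremum when `φ 0 = 0` (take `v = 0`). -/
def complementary (φ : ℝ≥0 → ℝ≥0∞) (u : ℝ≥0) : ℝ≥0∞ :=
  ⨆ v : ℝ≥0, ((u * v : ℝ≥0) : ℝ≥0∞) - φ v

theorem tsum_norm_inner_sq {H ι : Type*} [NormedAddCommGroup H] [InnerProductSpace ℂ H]
    (b : HilbertBasis ι ℂ H) (v : H) :
    ∑' i, ENNReal.ofReal (‖inner ℂ (b i) v‖ ^ 2) = ENNReal.ofReal (‖v‖ ^ 2) := by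
  have h := b.hasSum_inner_mul_inner v v
  have h2 : HasSum (fun i => ‖inner ℂ (b i) v‖ ^ 2) (‖v‖ ^ 2) := by
    have h3 := Complex.hasSum_re h
    have e : (inner ℂ v v).re = ‖v‖ ^ 2 := by
      rw [inner_self_eq_norm_sq_to_K]; norm_cast
    rw [e] at h3
    convert h3 using 2 with i
    rw [← inner_conj_symm v (b i), Complex.conj_mul']
    norm_cast
  rw [← h2.tsum_eq, ENNReal.ofReal_tsum_of_nonneg (fun i => by positivity) h2.summable]

variable {H : Type*} [NormedAddCommGroup H] [InnerProductSpace ℂ H] [CompleteSpace H]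

/-- The span of the eigenvectors of `|x| = (x* x)^(1/2)` with eigenvalue larger than `t`. Its
dimension is the number of eigenvalues of `|x|` larger than `t`, counted with multiplicity. -/
def eigenspaceAbove (x : H →L[ℂ] H) (t : ℝ≥0) : Submodule ℂ H :=
  ⨆ μ : {μ : ℝ≥0 // t < μ},
    Module.End.eigenspace ((CFC.abs x : H →L[ℂ] H) : Module.End ℂ H) (((μ : ℝ≥0) : ℝ) : ℂ)

/-- The singular values of a compact operator `x`: the eigenvalues of `|x|` in decreasing order,
counted with multiplicity, indexed from `0`, and continued by `0` if there are only finitely many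
positive ones. That is, `s_n(x)` is the least `t ≥ 0` such that at most `n` eigenvalues of `|x|`,
counted with multiplicity, are larger than `t`. -/
def singularValue (x : H →L[ℂ] H) (n : ℕ) : ℝ≥0 :=
  sInf {t : ℝ≥0 | Module.rank ℂ (eigenspaceAbove x t) ≤ (n : Cardinal)}

/-- The modular `Tr(φ(x)) = ∑ₙ φ(sₙ(x))` of a compact operator `x`. -/
def modular (φ : ℝ≥0 → ℝ≥0∞) (x : H →L[ℂ] H) : ℝ≥0∞ :=
  ∑' n : ℕ, φ (singularValue x n)

/-- The noncommutative Orlicz sequence space `S_φ`: the compact operators `x` with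
`Tr(φ(l x)) < ∞` for some `l > 0`. -/
def orliczSpace (φ : ℝ≥0 → ℝ≥0∞) : Set (H →L[ℂ] H) :=
  {x | IsCompactOperator x ∧ ∃ l : ℝ, 0 < l ∧ modular φ ((l : ℂ) • x) < ∞}

/-- The Luxemburg norm `‖x‖_φ = inf {l > 0 : Tr(φ(x / l)) ≤ 1}`. -/
def luxemburgNorm (φ : ℝ≥0 → ℝ≥0∞) (x : H →L[ℂ] H) : ℝ :=
  sInf {l : ℝ | 0 < l ∧ modular φ ((l : ℂ)⁻¹ • x) ≤ 1}

/-- The trace class `S_1`: the compact operators with summable singular values. -/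
def traceClass : Set (H →L[ℂ] H) :=
  {x | IsCompactOperator x ∧ Summable fun n : ℕ => singularValue x n}

/-- The diagonal sum `∑ᵢ ⟨bᵢ, T bᵢ⟩` in `[0,∞]` of a positive operator along a Hilbert basis. -/
def diagSum {ι : Type*} (b : HilbertBasis ι ℂ H) (T : H →L[ℂ] H) : ℝ≥0∞ :=
  ∑' i : ι, ENNReal.ofReal (inner ℂ (b i) (T (b i))).re

/-- The usual trace `Tr T = ∑ᵢ ⟨eᵢ, T eᵢ⟩` in `[0,∞]` of a positive operator `T`, along some
Hilbert basis; `posTrace_eq_diagSum` says that every Hilbert basis gives the same value. -/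
def posTrace (T : H →L[ℂ] H) : ℝ≥0∞ :=
  diagSum (exists_hilbertBasis ℂ H).choose_spec.choose T

theorem diagSum_star_mul_self {ι κ : Type*} (b : HilbertBasis ι ℂ H) (c : HilbertBasis κ ℂ H)
    (S : H →L[ℂ] H) : diagSum b (star S * S) = diagSum c (S * star S) := by
  have key : ∀ (R : H →L[ℂ] H) (v : H), (inner ℂ v ((star R * R) v)).re = ‖R v‖ ^ 2 := by
    intro R v
    rw [mul_apply_eq_comp, ContinuousLinearMap.star_eq_adjoint,
      ContinuousLinearMap.adjoint_inner_right, inner_self_eq_norm_sq_to_K]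
    norm_cast
  have key' : ∀ v : H, (inner ℂ v ((S * star S) v)).re = ‖star S v‖ ^ 2 := by
    intro v; simpa using key (star S) v
  unfold diagSum
  simp_rw [key, key', ← tsum_norm_inner_sq c (S _), ← tsum_norm_inner_sq b (star S _)]
  rw [ENNReal.tsum_comm]
  refine tsum_congr fun j => tsum_congr fun i => ?_
  rw [ContinuousLinearMap.star_eq_adjoint, ContinuousLinearMap.adjoint_inner_right,
    norm_inner_symm]

/-- The trace of a positive operator does not depend on the Hilbert basis. -/
theorem posTrace_eq_diagSum {ι : Type*} (b : HilbertBasis ι ℂ H) (T : H →L[ℂ] H) (hT : 0 ≤ T) :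
    posTrace T = diagSum b T := by
  have h1 : star (CFC.sqrt T) = CFC.sqrt T :=
    (IsSelfAdjoint.of_nonneg (CFC.sqrt_nonneg T)).star_eq
  have h := diagSum_star_mul_self (exists_hilbertBasis ℂ H).choose_spec.choose b (CFC.sqrt T)
  rw [h1, CFC.sqrt_mul_sqrt_self T hT] at h
  exact h

/-- The Orlicz norm `‖x‖ᵒ_φ = sup {Tr |x y| : y compact, Tr(ψ(y)) ≤ 1}` in `[0,∞]`, where `ψ` is
the complementary function of `φ`. -/
def orliczNorm (φ : ℝ≥0 → ℝ≥0∞) (x : H →L[ℂ] H) : ℝ≥0∞ :=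
  ⨆ y ∈ {y : H →L[ℂ] H | IsCompactOperator y ∧ modular (complementary φ) y ≤ 1},
    posTrace (CFC.abs (x * y))

end

end NCOrlicz

open NCOrlicz

/-! Everything reduces to sums over eigenvalues. A compact `x` has a Hilbert basis diagonalizing
`|x|`; its eigenvalues, in whatever order, have the same counting function as the singular values
(`encard_lt_singularValue`), so by a layer-cake formula Tr f(x) is the sum of f over the eigenvalues
(`IsEigenbasis.modular_eq`).

The norm statements then use only f(tu) ≤ t f(u) for t ≤ 1, which gives the inequalities between
norm and modular, and lower semicontinuity, by which the Luxemburg infimum is attained.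

For Hölder, let a_i and d_j be the eigenvalues of |x| and |y|. Expanding Tr |xy| in the two
eigenbases bounds it by a sum of a_i d_j weighted by a matrix with row and column sums at most 1.
Young's inequality a_i d_j ≤ φ(a_i) + ψ(d_j) thus gives Tr |xy| ≤ Tr φ(x) + Tr ψ(y)
(`posTrace_abs_mul_le`). Rescaling `x` and `y` yields the rest, as Tr |xy| is the sum of the
singular values of xy. -/

namespace NCOrlicz

/-! ### Diagonalization of |x| and counting of singular values -/

section Operators

variable {H : Type*} [NormedAddCommGroup H] [InnerProductSpace ℂ H] [CompleteSpace H]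

/-- Two operators with `‖R v‖ = ‖S v‖` for all `v` differ by a contraction on the left. -/
theorem exists_contraction_of_norm_eq {R S : H →L[ℂ] H} (h : ∀ v, ‖S v‖ = ‖R v‖) :
    ∃ W : H →L[ℂ] H, ‖W‖ ≤ 1 ∧ W * R = S := by
  set K : Submodule ℂ H := (LinearMap.range (R : H →ₗ[ℂ] H)).topologicalClosure with hK
  have hmem : ∀ v, R v ∈ K := fun v =>
    Submodule.le_topologicalClosure _ (LinearMap.mem_range_self (R : H →ₗ[ℂ] H) v)
  have : CompleteSpace K := (Submodule.isClosed_topologicalClosure _).completeSpace_coe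
  let e : H →ₗ[ℂ] K := (R : H →ₗ[ℂ] H).codRestrict K hmem
  have hdense : DenseRange e := by
    intro z
    rw [closure_subtype]
    have hz : (z : H) ∈ closure (LinearMap.range (R : H →ₗ[ℂ] H) : Set H) := z.2
    convert hz using 2
    ext w
    constructor
    · rintro ⟨_, ⟨v, rfl⟩, rfl⟩
      exact ⟨v, rfl⟩
    · rintro ⟨v, rfl⟩
      exact ⟨e v, ⟨v, rfl⟩, rfl⟩
  have hnorm : ∀ v, ‖(S : H →ₗ[ℂ] H) v‖ ≤ 1 * ‖e v‖ := fun v => by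
    rw [one_mul]; exact (h v).le
  -- The map R v ↦ S v is isometric on the range of R; it extends to the closure, and the orthogonal
  -- projection carries it to the whole space.
  refine ⟨((S : H →ₗ[ℂ] H).extendOfNorm e).comp K.orthogonalProjectionOnto, ?_, ?_⟩
  · refine ContinuousLinearMap.opNorm_le_bound _ zero_le_one fun v => ?_
    refine (LinearMap.norm_extendOfNorm_apply_le hdense 1 hnorm _).trans ?_
    gcongr
    exact K.norm_orthogonalProjectionOnto_apply_le v
  · ext v
    have h1 : K.orthogonalProjectionOnto (R v) = e v :=
      Submodule.orthogonalProjectionOnto_mem_subspace_eq_self (K := K) (e v)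
    change (S : H →ₗ[ℂ] H).extendOfNorm e (K.orthogonalProjectionOnto (R v)) = S v
    rw [h1]
    exact LinearMap.extendOfNorm_eq hdense ⟨1, hnorm⟩ v

theorem norm_abs_apply (x : H →L[ℂ] H) (v : H) : ‖(CFC.abs x : H →L[ℂ] H) v‖ = ‖x v‖ := by
  have key : ∀ (R : H →L[ℂ] H), (inner ℂ v ((star R * R) v)).re = ‖R v‖ ^ 2 := by
    intro R
    rw [mul_apply_eq_comp, ContinuousLinearMap.star_eq_adjoint,
      ContinuousLinearMap.adjoint_inner_right, inner_self_eq_norm_sq_to_K]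
    norm_cast
  have h1 : star (CFC.abs x) = CFC.abs x :=
    (IsSelfAdjoint.of_nonneg (CFC.abs_nonneg x)).star_eq
  have h2 := key (CFC.abs x)
  rw [h1, CFC.abs_mul_abs, key x] at h2
  exact ((sq_eq_sq₀ (norm_nonneg _) (norm_nonneg _)).1 h2).symm

theorem exists_contraction_mul_abs (x : H →L[ℂ] H) :
    ∃ W : H →L[ℂ] H, ‖W‖ ≤ 1 ∧ W * CFC.abs x = x :=
  exists_contraction_of_norm_eq fun v => (norm_abs_apply x v).symm

theorem exists_contraction_mul_eq_abs (x : H →L[ℂ] H) :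
    ∃ W : H →L[ℂ] H, ‖W‖ ≤ 1 ∧ W * x = CFC.abs x :=
  exists_contraction_of_norm_eq (norm_abs_apply x)

theorem isCompactOperator_abs {x : H →L[ℂ] H} (hx : IsCompactOperator x) :
    IsCompactOperator (CFC.abs x : H →L[ℂ] H) := by
  obtain ⟨W, -, hW⟩ := exists_contraction_mul_eq_abs x
  rw [← hW]
  exact hx.clm_comp W

theorem isSymmetric_abs (x : H →L[ℂ] H) :
    ((CFC.abs x : H →L[ℂ] H) : H →ₗ[ℂ] H).IsSymmetric :=
  (IsSelfAdjoint.of_nonneg (CFC.abs_nonneg x)).isSymmetric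

theorem inner_abs_apply (x : H →L[ℂ] H) (v w : H) :
    inner ℂ ((CFC.abs x : H →L[ℂ] H) v) w = inner ℂ v ((CFC.abs x : H →L[ℂ] H) w) :=
  isSymmetric_abs x v w

theorem re_inner_abs_nonneg (x : H →L[ℂ] H) (v : H) :
    0 ≤ (inner ℂ v ((CFC.abs x : H →L[ℂ] H) v)).re := by
  have h := (ContinuousLinearMap.nonneg_iff_isPositive _).1 (CFC.abs_nonneg x)
  exact h.re_inner_nonneg_right v

/-- `b` is a Hilbert basis of eigenvectors of `|x|` with eigenvalues `a`. -/
def IsEigenbasis {ι : Type*} (x : H →L[ℂ] H) (b : HilbertBasis ι ℂ H) (a : ι → ℝ≥0) : Prop :=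
  ∀ i, (CFC.abs x : H →L[ℂ] H) (b i) = ((a i : ℝ) : ℂ) • b i

/-- Spectral theorem: the eigenspaces, kernel included, are mutually orthogonal with dense sum, so
Hilbert bases of each glue together. -/
theorem exists_isEigenbasis.{u} {H : Type u} [NormedAddCommGroup H] [InnerProductSpace ℂ H]
    [CompleteSpace H] {x : H →L[ℂ] H} (hx : IsCompactOperator x) :
    ∃ (ι : Type u) (b : HilbertBasis ι ℂ H) (a : ι → ℝ≥0), IsEigenbasis x b a := by
  set P : H →L[ℂ] H := CFC.abs x with hP
  let E : ℂ → Submodule ℂ H := fun μ => Module.End.eigenspace (P : Module.End ℂ H) μ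
  have hEc : ∀ μ, CompleteSpace (E μ) := fun μ => by
    have : IsClosed (E μ : Set H) := by
      have h : (E μ : Set H) = {v | P v = μ • v} := by
        ext v; exact Module.End.mem_eigenspace_iff
      rw [h]
      exact isClosed_eq P.continuous (continuous_const_smul μ)
    exact this.completeSpace_coe
  choose w b hb using fun μ => exists_hilbertBasis ℂ (E μ)
  have hon : Orthonormal ℂ fun a : Σ μ, w μ => ((b a.1 a.2 : E a.1) : H) :=
    (isSymmetric_abs x).orthogonalFamily_eigenspaces.orthonormal_sigma_orthonormal
      fun μ => (b μ).orthonormal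
  have hbot : (Submodule.span ℂ (range fun a : Σ μ, w μ => ((b a.1 a.2 : E a.1) : H)))ᗮ = ⊥ := by
    rw [eq_bot_iff, ← ContinuousLinearMap.orthogonalComplement_iSup_eigenspaces_eq_bot
      (isCompactOperator_abs hx) (isSymmetric_abs x)]
    intro v hv
    rw [Submodule.mem_orthogonal'] at hv
    rw [← Submodule.iInf_orthogonal, Submodule.mem_iInf]
    intro μ
    rw [Submodule.mem_orthogonal']
    intro u hu
    have h := (b μ).hasSum_repr ⟨u, hu⟩
    have h2 := (h.mapL ((innerSL ℂ v).comp (E μ).subtypeL))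
    refine h2.unique ?_
    convert hasSum_zero with i
    have := hv _ (Submodule.subset_span ⟨⟨μ, i⟩, rfl⟩)
    simp only [map_smul]
    simp [this]
  have heig : ∀ a : Σ μ, w μ, P (b a.1 a.2 : E a.1) = a.1 • ((b a.1 a.2 : E a.1) : H) := fun a =>
    Module.End.mem_eigenspace_iff.1 (b a.1 a.2).2
  have hinner : ∀ a : Σ μ, w μ, inner ℂ ((b a.1 a.2 : E a.1) : H) (P (b a.1 a.2 : E a.1)) = a.1 :=
    fun a => by
      have h1 : ‖((b a.1 a.2 : E a.1) : H)‖ = 1 := hon.1 a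
      rw [heig, inner_smul_right, inner_self_eq_norm_sq_to_K, h1]
      simp
  have hnonneg : ∀ a : Σ μ, w μ, (((a.1.re.toNNReal : ℝ≥0) : ℝ) : ℂ) = a.1 := fun a => by
    have h := re_inner_abs_nonneg x ((b a.1 a.2 : E a.1) : H)
    rw [← hP, hinner] at h
    have him : inner ℂ ((b a.1 a.2 : E a.1) : H) (P (b a.1 a.2 : E a.1))
        = (starRingEnd ℂ) (inner ℂ ((b a.1 a.2 : E a.1) : H) (P (b a.1 a.2 : E a.1))) := by
      rw [inner_conj_symm, inner_abs_apply]
    rw [hinner] at him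
    rw [Real.coe_toNNReal _ h]
    exact Complex.conj_eq_iff_re.1 him.symm
  refine ⟨Σ μ, w μ, HilbertBasis.mkOfOrthogonalEqBot hon hbot, fun a => a.1.re.toNNReal,
    fun a => ?_⟩
  rw [HilbertBasis.coe_mkOfOrthogonalEqBot, hnonneg]
  exact heig a

namespace IsEigenbasis

variable {ι : Type*} {x : H →L[ℂ] H} {b : HilbertBasis ι ℂ H} {a : ι → ℝ≥0}

theorem inner_apply (h : IsEigenbasis x b a) (i : ι) (v : H) :
    inner ℂ (b i) ((CFC.abs x : H →L[ℂ] H) v) = ((a i : ℝ) : ℂ) * inner ℂ (b i) v := by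
  rw [← inner_abs_apply, h i, inner_smul_left, Complex.conj_ofReal]

theorem le_nnnorm (h : IsEigenbasis x b a) (i : ι) : a i ≤ ‖(CFC.abs x : H →L[ℂ] H)‖₊ := by
  have h1 := (CFC.abs x : H →L[ℂ] H).le_opNorm (b i)
  rw [h i, norm_smul, b.orthonormal.1 i] at h1
  rw [← NNReal.coe_le_coe]
  simpa only [Complex.norm_real, NNReal.norm_eq, mul_one, coe_nnnorm] using h1

theorem smul (h : IsEigenbasis x b a) (c : ℝ≥0) :
    IsEigenbasis (((c : ℝ) : ℂ) • x) b (fun i => c * a i) := by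
  intro i
  rw [CFC.abs_smul, smul_apply, h i]
  simp only [Complex.norm_real, NNReal.norm_eq, NNReal.coe_mul, Complex.ofReal_mul, mul_smul,
    Complex.coe_smul]

/-- Otherwise |x| would map an infinite orthonormal family to vectors more than t apart, leaving no
convergent subsequence. -/
theorem finite (h : IsEigenbasis x b a) (hx : IsCompactOperator x) {t : ℝ≥0} (ht : 0 < t) :
    {i | t < a i}.Finite := by
  by_contra hinf
  let e := Set.Infinite.natEmbedding _ hinf
  set P : H →L[ℂ] H := CFC.abs x
  have hc := (isCompactOperator_abs hx).isCompact_closure_image_closedBall 1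
  have hu : ∀ n, P (b (e n)) ∈ closure (P '' Metric.closedBall 0 1) := fun n =>
    subset_closure ⟨_, by simp [b.orthonormal.1], rfl⟩
  obtain ⟨z, -, φ, hφ, hlim⟩ := hc.tendsto_subseq hu
  have hcau := hlim.cauchySeq
  rw [Metric.cauchySeq_iff] at hcau
  obtain ⟨N, hN⟩ := hcau t ht
  have h1 := hN N le_rfl (N + 1) (Nat.le_succ N)
  have hne : (e (φ N) : ι) ≠ e (φ (N + 1)) := fun heq => by
    have := hφ.injective (e.injective (Subtype.ext heq))
    omega
  have h2 : ‖P (b (e (φ N))) - P (b (e (φ (N + 1))))‖ ^ 2 =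
      (a (e (φ N)) : ℝ) ^ 2 + (a (e (φ (N + 1))) : ℝ) ^ 2 := by
    rw [@norm_sub_sq ℂ, h, h, norm_smul, norm_smul, b.orthonormal.1, b.orthonormal.1,
      inner_smul_left, inner_smul_right, b.orthonormal.2 hne]
    simp
  have h3 : (t : ℝ) < a (e (φ N)) := (e (φ N)).2
  simp only [Function.comp_apply, dist_eq_norm] at h1
  have h4 : ‖P (b (e (φ N))) - P (b (e (φ (N + 1))))‖ ^ 2 < (t : ℝ) ^ 2 := by gcongr
  have h5 : (t : ℝ) ^ 2 < (a (e (φ N)) : ℝ) ^ 2 := by gcongr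
  nlinarith [sq_nonneg (a (e (φ (N + 1))) : ℝ)]

theorem eigenspaceAbove_eq (h : IsEigenbasis x b a) (hx : IsCompactOperator x) (t : ℝ≥0) :
    eigenspaceAbove x t = Submodule.span ℂ (b '' {i | t < a i}) := by
  apply le_antisymm
  · refine iSup_le fun μ v hv => ?_
    obtain ⟨μ, hμ⟩ := μ
    rw [Module.End.mem_eigenspace_iff] at hv
    have hμ0 : 0 < μ := (zero_le).trans_lt hμ
    -- Finite multiplicity makes the expansion of an eigenvector a finite sum, so the algebraic span
    -- suffices, without closure.
    have hfin : {i | a i = μ}.Finite :=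
      (h.finite hx (half_pos hμ0)).subset fun i (hi : a i = μ) => by
        change μ / 2 < a i
        rw [hi]; exact NNReal.half_lt_self hμ0.ne'
    have hzero : ∀ i ∉ hfin.toFinset, b.repr v i • b i = 0 := by
      intro i hi
      rw [Set.Finite.mem_toFinset] at hi
      have h1 := h.inner_apply i v
      have h2 : (CFC.abs x : H →L[ℂ] H) v = ((μ : ℝ) : ℂ) • v := hv
      rw [h2, inner_smul_right, mul_eq_mul_right_iff] at h1
      rcases h1 with h1 | h1
      · exact absurd (by exact_mod_cast h1.symm) hi
      · rw [b.repr_apply_apply, h1, zero_smul]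
    rw [← (b.hasSum_repr v).tsum_eq, tsum_eq_sum hzero]
    refine Submodule.sum_mem _ fun i hi => Submodule.smul_mem _ _ (Submodule.subset_span ⟨i, ?_, rfl⟩)
    rw [Set.Finite.mem_toFinset] at hi
    change t < a i
    rw [show a i = μ from hi]; exact hμ
  · rw [Submodule.span_le]
    rintro _ ⟨i, hi, rfl⟩
    refine Submodule.mem_iSup_of_mem (⟨a i, hi⟩ : {μ : ℝ≥0 // t < μ}) ?_
    rw [Module.End.mem_eigenspace_iff]
    exact h i

theorem rank_eigenspaceAbove_le_iff (h : IsEigenbasis x b a) (hx : IsCompactOperator x) (t : ℝ≥0)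
    (n : ℕ) : Module.rank ℂ (eigenspaceAbove x t) ≤ n ↔ {i | t < a i}.encard ≤ n := by
  have hli : LinearIndependent ℂ fun i : {i | t < a i} => b i :=
    b.orthonormal.linearIndependent.comp _ Subtype.val_injective
  have hr : b '' {i | t < a i} = range fun i : {i | t < a i} => b i := by
    rw [image_eq_range]
  rw [h.eigenspaceAbove_eq hx, hr, rank_span hli, ← hr, ← Cardinal.toENat_le_natCast,
    ← (b.orthonormal.linearIndependent.injective.injOn (s := {i | t < a i})).encard_image]
  rfl

theorem lt_singularValue_iff (h : IsEigenbasis x b a) (hx : IsCompactOperator x) (t : ℝ≥0)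
    (n : ℕ) : t < singularValue x n ↔ n < {i | t < a i}.encard := by
  unfold singularValue
  simp_rw [h.rank_eigenspaceAbove_le_iff hx]
  constructor
  · intro hlt
    by_contra! hle
    have hmem : t ∈ {t | {i | t < a i}.encard ≤ n} := hle
    exact absurd (csInf_le (OrderBot.bddBelow _) hmem) (not_le.2 hlt)
  · intro hlt
    obtain ⟨F, hF, hcard⟩ := Set.exists_subset_encard_eq (Order.add_one_le_of_lt hlt)
    have hfin : F.Finite := Set.finite_of_encard_eq_coe (k := n + 1) (by exact_mod_cast hcard)
    -- Only n + 1 eigenvalues above t are kept, so some t' > t lies below all of them; this makes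
    -- the bound on the infimum strict.
    obtain ⟨t', htt', ht'⟩ : ∃ t', t < t' ∧ ∀ i ∈ F, t' < a i := by
      have : ∀ᶠ s in 𝓝[>] t, ∀ i ∈ F, s < a i := by
        rw [Filter.eventually_all_finite hfin]
        intro i hi
        exact nhdsWithin_le_nhds (Iio_mem_nhds (hF hi))
      exact (this.and self_mem_nhdsWithin).exists.imp fun s hs => ⟨hs.2, hs.1⟩
    refine htt'.trans_le (le_csInf ⟨‖(CFC.abs x : H →L[ℂ] H)‖₊, ?_⟩ fun s hs => ?_)
    · have : {i | ‖(CFC.abs x : H →L[ℂ] H)‖₊ < a i} = ∅ := by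
        ext i; simpa using h.le_nnnorm i
      simp [this]
    · by_contra! hst
      have h1 : F.encard ≤ {i | s < a i}.encard :=
        Set.encard_le_encard fun i hi => hst.trans (ht' i hi)
      rw [hcard] at h1
      have h2 := h1.trans hs
      have h3 : n + 1 ≤ n := by exact_mod_cast h2
      omega

theorem encard_lt_singularValue (h : IsEigenbasis x b a) (hx : IsCompactOperator x) (t : ℝ≥0) :
    {n | t < singularValue x n}.encard = {i | t < a i}.encard := by
  simp_rw [h.lt_singularValue_iff hx]
  generalize {i | t < a i}.encard = N
  induction N using ENat.recTopCoe with
  | top => simp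
  | coe k =>
    have : {n : ℕ | (n : ℕ∞) < k} = (Finset.range k : Set ℕ) := by ext; simp
    rw [this, Set.encard_coe_eq_coe_finsetCard, Finset.card_range]

end IsEigenbasis

end Operators

/-! ### Sums determined by the distribution function -/

section LayerCake

open MeasureTheory

/-- Superlevel sets are upward closed by monotonicity and open by lower semicontinuity; f 0 = 0
excludes the whole half-line, which is not an open ray. -/
theorem exists_superlevel_eq_Ioi {f : ℝ≥0 → ℝ≥0∞} (hm : Monotone f) (hl : LowerSemicontinuous f)
    (h0 : f 0 = 0) (r : ℝ≥0∞) : (∃ t, ∀ s, r < f s ↔ t < s) ∨ ∀ s, ¬ r < f s := by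
  by_cases hne : ∃ s, r < f s
  · left
    refine ⟨sInf {s | r < f s}, fun s => ⟨fun hs => ?_, fun hs => ?_⟩⟩
    · refine lt_of_le_of_ne (csInf_le (OrderBot.bddBelow _) hs) fun heq => ?_
      have hs0 : 0 < s := pos_iff_ne_zero.2 fun hz => by simp [hz, h0] at hs
      have hev : ∀ᶠ u in 𝓝[<] s, r < f u := nhdsWithin_le_nhds (hl s r hs)
      have : (𝓝[<] s).NeBot := nhdsLT_neBot_of_exists_lt ⟨0, hs0⟩
      obtain ⟨u, hu, hus⟩ := (hev.and self_mem_nhdsWithin).exists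
      have hmem : u ∈ {s | r < f s} := hu
      exact absurd (heq ▸ csInf_le (OrderBot.bddBelow _) hmem) (not_le.2 hus)
    · obtain ⟨u, hu, hus⟩ := exists_lt_of_csInf_lt hne hs
      exact lt_of_lt_of_le hu (hm hus.le)
  · right; push Not at hne; simpa using hne

theorem lintegral_Ioi_indicator_lt (c : ℝ≥0∞) :
    ∫⁻ r in Ioi (0 : ℝ), {r : ℝ | ENNReal.ofReal r < c}.indicator 1 r = c := by
  have hms : MeasurableSet {r : ℝ | ENNReal.ofReal r < c} :=
    measurableSet_lt ENNReal.measurable_ofReal measurable_const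
  rw [lintegral_indicator_one hms, Measure.restrict_apply hms]
  induction c using ENNReal.recTopCoe with
  | top =>
    simp
  | coe c =>
    have : {r : ℝ | ENNReal.ofReal r < c} ∩ Ioi 0 = Ioo 0 (c : ℝ) := by
      ext r
      simp only [mem_inter_iff, mem_ofPred_eq, mem_Ioi, mem_Ioo]
      constructor
      · rintro ⟨h1, h2⟩
        exact ⟨h2, by rwa [ENNReal.ofReal_lt_coe_iff h2.le] at h1⟩
      · rintro ⟨h1, h2⟩
        exact ⟨by rwa [ENNReal.ofReal_lt_coe_iff h1.le], h1⟩
    rw [this, Real.volume_Ioo]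
    simp

theorem tsum_eq_lintegral_encard {ι : Type*} {a : ι → ℝ≥0} (ha : ∀ t, 0 < t → {i | t < a i}.Finite)
    {f : ℝ≥0 → ℝ≥0∞} (h0 : f 0 = 0) :
    ∑' i, f (a i) = ∫⁻ r in Ioi (0 : ℝ), ({i | ENNReal.ofReal r < f (a i)}.encard : ℝ≥0∞) := by
  -- Exchanging sum and integral needs a countable index set; the indices with a i = 0 contribute
  -- nothing.
  have hcount : {i | 0 < a i}.Countable := by
    have : {i | 0 < a i} = ⋃ n : ℕ, {i | 1 / ((n : ℝ≥0) + 1) < a i} := by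
      ext i
      simp only [mem_ofPred_eq, mem_iUnion]
      exact ⟨fun h => exists_nat_one_div_lt h, fun ⟨n, hn⟩ => zero_le.trans_lt hn⟩
    rw [this]
    exact countable_iUnion fun n => (ha _ (by positivity)).countable
  have := hcount.to_subtype
  have hsub : ∀ (g : ι → ℝ≥0∞), (∀ i, a i = 0 → g i = 0) → ∑' i, g i = ∑' i : {i | 0 < a i}, g i :=
    fun g hg => (tsum_subtype_eq_of_support_subset fun i hi =>
      pos_iff_ne_zero.2 fun hz => hi (hg i hz)).symm
  rw [hsub _ fun i hi => by rw [hi, h0]]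
  have hms : ∀ c : ℝ≥0∞, MeasurableSet {r : ℝ | ENNReal.ofReal r < c} := fun c =>
    measurableSet_lt ENNReal.measurable_ofReal measurable_const
  conv_lhs => enter [1, i]; rw [← lintegral_Ioi_indicator_lt (f (a i))]
  rw [← lintegral_tsum fun i => ((measurable_one.indicator (hms _)).aemeasurable)]
  refine lintegral_congr fun r => ?_
  rw [← ENNReal.tsum_set_one, tsum_subtype {i | ENNReal.ofReal r < f (a i)} fun _ => (1 : ℝ≥0∞),
    hsub _ fun i hi => by simp [hi, h0]]
  rfl

/-- Two families of nonnegative numbers with the same distribution have the same `f`-sums. -/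
theorem tsum_comp_eq_of_encard_eq {ι κ : Type*} {a : ι → ℝ≥0} {b : κ → ℝ≥0}
    (ha : ∀ t, 0 < t → {i | t < a i}.Finite)
    (hab : ∀ t, {i | t < a i}.encard = {k | t < b k}.encard)
    {f : ℝ≥0 → ℝ≥0∞} (hm : Monotone f) (hl : LowerSemicontinuous f) (h0 : f 0 = 0) :
    ∑' i, f (a i) = ∑' k, f (b k) := by
  have hb : ∀ t, 0 < t → {k | t < b k}.Finite := fun t ht => by
    rw [← Set.encard_lt_top_iff, ← hab]
    exact (ha t ht).encard_lt_top
  rw [tsum_eq_lintegral_encard ha h0, tsum_eq_lintegral_encard hb h0]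
  refine lintegral_congr fun r => ?_
  rcases exists_superlevel_eq_Ioi hm hl h0 (ENNReal.ofReal r) with ⟨t, ht⟩ | h
  · simp_rw [ht, hab]
  · simp [h]

end LayerCake

section Modular

variable {H : Type*} [NormedAddCommGroup H] [InnerProductSpace ℂ H] [CompleteSpace H]

theorem IsEigenbasis.modular_eq {ι : Type*} {x : H →L[ℂ] H} {b : HilbertBasis ι ℂ H}
    {a : ι → ℝ≥0} (h : IsEigenbasis x b a) (hx : IsCompactOperator x) {f : ℝ≥0 → ℝ≥0∞}
    (hm : Monotone f) (hl : LowerSemicontinuous f) (h0 : f 0 = 0) :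
    modular f x = ∑' i, f (a i) :=
  (tsum_comp_eq_of_encard_eq (fun _ ht => h.finite hx ht)
    (fun t => (h.encard_lt_singularValue hx t).symm) hm hl h0).symm

end Modular

/-! ### Trace inequality for products -/

section Trace

variable {H : Type*} [NormedAddCommGroup H] [InnerProductSpace ℂ H] [CompleteSpace H]

omit [CompleteSpace H] in
theorem tsum_norm_inner_contraction_le {ι : Type*} (b : HilbertBasis ι ℂ H) {B : H →L[ℂ] H}
    (hB : ‖B‖ ≤ 1) {v : H} (hv : ‖v‖ = 1) :
    ∑' i, ENNReal.ofReal (‖inner ℂ (b i) (B v)‖ ^ 2) ≤ 1 := by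
  rw [tsum_norm_inner_sq b]
  have h : ‖B v‖ ≤ 1 := by
    have := B.le_of_opNorm_le hB v
    rwa [hv, one_mul] at this
  rw [ENNReal.ofReal_le_one]
  exact pow_le_one₀ (norm_nonneg _) h

theorem tsum_norm_inner_contraction_le' {ι : Type*} (c : HilbertBasis ι ℂ H) {B : H →L[ℂ] H}
    (hB : ‖B‖ ≤ 1) {v : H} (hv : ‖v‖ = 1) :
    ∑' j, ENNReal.ofReal (‖inner ℂ v (B (c j))‖ ^ 2) ≤ 1 := by
  have h := tsum_norm_inner_contraction_le c (B := star B) (by rwa [norm_star]) hv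
  convert h using 5 with j
  rw [ContinuousLinearMap.star_eq_adjoint, ContinuousLinearMap.adjoint_inner_right,
    norm_inner_symm]

theorem ofReal_re_le_enorm (z : ℂ) : ENNReal.ofReal z.re ≤ ‖z‖ₑ := by
  rw [← ofReal_norm]
  exact ENNReal.ofReal_le_ofReal (Complex.re_le_norm z)

/-- Doubly substochastic weights: F is summed against rows and G against columns. -/
theorem tsum_tsum_mul_le {ι κ : Type*} {M : ι → κ → ℝ≥0∞} (hr : ∀ i, ∑' j, M i j ≤ 1)
    (hc : ∀ j, ∑' i, M i j ≤ 1) (F : ι → ℝ≥0∞) (G : κ → ℝ≥0∞) :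
    ∑' j, ∑' i, (F i + G j) * M i j ≤ ∑' i, F i + ∑' j, G j := by
  simp_rw [add_mul, ENNReal.tsum_add]
  refine add_le_add ?_ (ENNReal.tsum_le_tsum fun j => ?_)
  · rw [ENNReal.tsum_comm]
    refine ENNReal.tsum_le_tsum fun i => ?_
    rw [ENNReal.tsum_mul_left]
    exact mul_le_of_le_one_right' (hr i)
  · rw [ENNReal.tsum_mul_left]
    exact mul_le_of_le_one_right' (hc j)

/-- A trace inequality: if the eigenvalues `a` of `|x|` and `d` of `|y|` satisfy
`a i * d j ≤ F i + G j`, then `Tr |x y| ≤ ∑ F + ∑ G`. -/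
theorem posTrace_abs_mul_le {ι κ : Type*} {x y : H →L[ℂ] H} {b : HilbertBasis ι ℂ H}
    {c : HilbertBasis κ ℂ H} {a : ι → ℝ≥0} {d : κ → ℝ≥0} (hb : IsEigenbasis x b a)
    (hc : IsEigenbasis y c d) {F : ι → ℝ≥0∞} {G : κ → ℝ≥0∞}
    (hFG : ∀ i j, ((a i * d j : ℝ≥0) : ℝ≥0∞) ≤ F i + G j) :
    posTrace (CFC.abs (x * y)) ≤ ∑' i, F i + ∑' j, G j := by
  obtain ⟨U, hU1, hU⟩ := exists_contraction_mul_abs x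
  obtain ⟨V, hV1, hV⟩ := exists_contraction_mul_abs y
  obtain ⟨W, hW1, hW⟩ := exists_contraction_mul_eq_abs (x * y)
  obtain ⟨A, hA1, hA⟩ : ∃ A : H →L[ℂ] H, ‖A‖ ≤ 1 ∧ ∀ u v, inner ℂ u (W (U v)) = inner ℂ (A u) v :=
    ⟨star (W * U), by
      rw [norm_star]
      exact (norm_mul_le _ _).trans (mul_le_one₀ hW1 (norm_nonneg _) hU1), fun u v => by
      rw [ContinuousLinearMap.star_eq_adjoint, ContinuousLinearMap.adjoint_inner_left]; rfl⟩
  rw [posTrace_eq_diagSum c _ (CFC.abs_nonneg _)]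
  -- With A = (WU)*, the trace of |xy| = W U |x| V |y| in the basis c has terms d_j a_i ⟨A c_j,
  -- b_i⟩⟨b_i, V c_j⟩. M comes from pq ≤ (p² + q²)/2; its row and column sums are at most 1 because
  -- A and V are contractions.
  let M : ι → κ → ℝ≥0∞ := fun i j => 2⁻¹ * (ENNReal.ofReal (‖inner ℂ (b i) (A (c j))‖ ^ 2) +
    ENNReal.ofReal (‖inner ℂ (b i) (V (c j))‖ ^ 2))
  have hhalf : (2⁻¹ : ℝ≥0∞) * (1 + 1) = 1 := by
    rw [one_add_one_eq_two]; exact ENNReal.inv_mul_cancel two_ne_zero ENNReal.ofNat_ne_top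
  have hMr : ∀ i, ∑' j, M i j ≤ 1 := fun i => by
    rw [ENNReal.tsum_mul_left, ENNReal.tsum_add, ← hhalf]
    gcongr
    · exact tsum_norm_inner_contraction_le' c hA1 (b.orthonormal.1 i)
    · exact tsum_norm_inner_contraction_le' c hV1 (b.orthonormal.1 i)
  have hMc : ∀ j, ∑' i, M i j ≤ 1 := fun j => by
    rw [ENNReal.tsum_mul_left, ENNReal.tsum_add, ← hhalf]
    gcongr
    · exact tsum_norm_inner_contraction_le b hA1 (c.orthonormal.1 j)
    · exact tsum_norm_inner_contraction_le b hV1 (c.orthonormal.1 j)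
  refine le_trans (ENNReal.tsum_le_tsum fun j => ?_) (tsum_tsum_mul_le hMr hMc F G)
  have happly : (CFC.abs (x * y) : H →L[ℂ] H) (c j) =
      ((d j : ℝ) : ℂ) • W (U ((CFC.abs x : H →L[ℂ] H) (V (c j)))) := by
    have h1 : ∀ v, U ((CFC.abs x : H →L[ℂ] H) v) = x v := fun v => DFunLike.congr_fun hU v
    have h2 : V ((CFC.abs y : H →L[ℂ] H) (c j)) = y (c j) := DFunLike.congr_fun hV (c j)
    rw [hc j, map_smul] at h2
    rw [← hW, h1, ← map_smul, ← map_smul, h2]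
    rfl
  have hinner : inner ℂ (c j) ((CFC.abs (x * y) : H →L[ℂ] H) (c j)) =
      ∑' i, ((d j : ℝ) : ℂ) * (inner ℂ (A (c j)) (b i) *
        (((a i : ℝ) : ℂ) * inner ℂ (b i) (V (c j)))) := by
    rw [happly, inner_smul_right, hA,
      ← (b.hasSum_inner_mul_inner (A (c j)) ((CFC.abs x : H →L[ℂ] H) (V (c j)))).tsum_eq,
      ← tsum_mul_left]
    simp_rw [hb.inner_apply]
  rw [hinner]
  refine (ofReal_re_le_enorm _).trans (enorm_tsum_le_tsum_enorm.trans
    (ENNReal.tsum_le_tsum fun i => ?_))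
  calc ‖((d j : ℝ) : ℂ) * (inner ℂ (A (c j)) (b i) *
        (((a i : ℝ) : ℂ) * inner ℂ (b i) (V (c j))))‖ₑ
      = ((a i * d j : ℝ≥0) : ℝ≥0∞) *
        ENNReal.ofReal (‖inner ℂ (b i) (A (c j))‖ * ‖inner ℂ (b i) (V (c j))‖) := by
        rw [← ofReal_norm, ← ENNReal.ofReal_coe_nnreal, ← ENNReal.ofReal_mul (by positivity)]
        congr 1
        rw [norm_mul, norm_mul, norm_mul, norm_inner_symm (A (c j))]
        simp only [Complex.norm_real, NNReal.norm_eq, NNReal.coe_mul]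
        ring
    _ ≤ (F i + G j) * M i j := by
        refine mul_le_mul' (hFG i j) ?_
        have h2 : (2⁻¹ : ℝ≥0∞) = ENNReal.ofReal 2⁻¹ := by
          rw [ENNReal.ofReal_inv_of_pos two_pos, ENNReal.ofReal_ofNat]
        simp only [M]
        rw [h2, ← ENNReal.ofReal_add (by positivity) (by positivity),
          ← ENNReal.ofReal_mul (by positivity)]
        refine ENNReal.ofReal_le_ofReal ?_
        nlinarith [sq_nonneg (‖inner ℂ (b i) (A (c j))‖ - ‖inner ℂ (b i) (V (c j))‖)]

theorem IsEigenbasis.posTrace_abs {ι : Type*} {x : H →L[ℂ] H} {b : HilbertBasis ι ℂ H}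
    {a : ι → ℝ≥0} (h : IsEigenbasis x b a) : posTrace (CFC.abs x) = ∑' i, (a i : ℝ≥0∞) := by
  rw [posTrace_eq_diagSum b _ (CFC.abs_nonneg _)]
  refine tsum_congr fun i => ?_
  rw [h i, inner_smul_right, inner_self_eq_norm_sq_to_K, b.orthonormal.1 i]
  simp

/-- The trace of `|x|` is the sum of the singular values of `x`. -/
theorem posTrace_abs_eq_tsum_singularValue {x : H →L[ℂ] H} (hx : IsCompactOperator x) :
    posTrace (CFC.abs x) = ∑' n, (singularValue x n : ℝ≥0∞) := by
  obtain ⟨ι, b, a, h⟩ := exists_isEigenbasis hx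
  rw [h.posTrace_abs]
  exact (h.modular_eq hx (f := fun t => (t : ℝ≥0∞)) ENNReal.coe_mono
    ENNReal.continuous_coe.lowerSemicontinuous rfl).symm

theorem mem_traceClass_of_posTrace_ne_top {x : H →L[ℂ] H} (hx : IsCompactOperator x)
    (h : posTrace (CFC.abs x) ≠ ∞) : x ∈ traceClass := by
  rw [posTrace_abs_eq_tsum_singularValue hx] at h
  exact ⟨hx, ENNReal.tsum_coe_ne_top_iff_summable.1 h⟩

theorem posTrace_abs_smul (c : ℝ≥0) (x : H →L[ℂ] H) :
    posTrace (CFC.abs (((c : ℝ) : ℂ) • x)) = c * posTrace (CFC.abs x) := by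
  unfold posTrace diagSum
  rw [← ENNReal.tsum_mul_left]
  refine tsum_congr fun i => ?_
  rw [CFC.abs_smul, ← ENNReal.ofReal_coe_nnreal, ← ENNReal.ofReal_mul c.coe_nonneg]
  congr 1
  rw [Complex.norm_real, NNReal.norm_eq, smul_apply, ← Complex.coe_smul, inner_smul_right,
    Complex.re_ofReal_mul]

end Trace

/-! ### Young functions and complementary functions -/

section Young

/-- The properties shared by an Orlicz function and its complementary function. -/
structure IsYoungFunction (f : ℝ≥0 → ℝ≥0∞) : Prop where
  mono : Monotone f
  lsc : LowerSemicontinuous f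
  map_zero : f 0 = 0
  map_mul_le : ∀ t u : ℝ≥0, t ≤ 1 → f (t * u) ≤ t * f u
  exists_one_lt : ∃ v, 1 < f v

theorem IsOrliczFunction.isYoungFunction {φ : ℝ≥0 → ℝ≥0∞} (h : IsOrliczFunction φ) :
    IsYoungFunction φ where
  mono := h.mono
  lsc := h.continuous.lowerSemicontinuous
  map_zero := h.map_zero
  map_mul_le t u ht := by
    have := h.convex.2 (mem_univ u) (mem_univ 0) (zero_le : 0 ≤ t) (zero_le : 0 ≤ 1 - t)
      (add_tsub_cancel_of_le ht)
    simpa [h.map_zero, ENNReal.smul_def] using this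
  exists_one_lt := (h.tendsto_top.eventually_const_lt ENNReal.one_lt_top).exists

theorem mul_le_add_complementary (φ : ℝ≥0 → ℝ≥0∞) (u v : ℝ≥0) :
    ((u * v : ℝ≥0) : ℝ≥0∞) ≤ φ u + complementary φ v := by
  rw [← tsub_le_iff_left, mul_comm u v]
  exact le_iSup (fun w : ℝ≥0 => ((v * w : ℝ≥0) : ℝ≥0∞) - φ w) u

/-- A supremum of continuous functions of u is lower semicontinuous; continuity is not claimed. -/
theorem IsOrliczFunction.isYoungFunction_complementary {φ : ℝ≥0 → ℝ≥0∞}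
    (h : IsOrliczFunction φ) : IsYoungFunction (complementary φ) where
  mono u v huv := by
    unfold complementary
    gcongr
  lsc := lowerSemicontinuous_iSup fun v => Continuous.lowerSemicontinuous
    ((ENNReal.continuous_sub_right _).comp
      (ENNReal.continuous_coe.comp (continuous_id.mul continuous_const)))
  map_zero := by simp [complementary]
  map_mul_le t u ht := by
    refine iSup_le fun v => ?_
    calc ((t * u * v : ℝ≥0) : ℝ≥0∞) - φ v
        ≤ (t : ℝ≥0∞) * ((u * v : ℝ≥0) : ℝ≥0∞) - t * φ v := by
          rw [mul_assoc, ENNReal.coe_mul]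
          refine tsub_le_tsub_left (mul_le_of_le_one_left' ?_) _
          exact_mod_cast ht
      _ = t * (((u * v : ℝ≥0) : ℝ≥0∞) - φ v) := by
          rw [ENNReal.mul_sub fun _ _ => ENNReal.coe_ne_top]
      _ ≤ t * complementary φ u := by
          gcongr
          exact le_iSup (fun w : ℝ≥0 => ((u * w : ℝ≥0) : ℝ≥0∞) - φ w) v
  exists_one_lt := by
    have hev : ∀ᶠ v in 𝓝[>] (0 : ℝ≥0), φ v < 1 :=
      nhdsWithin_le_nhds (h.continuous.continuousAt.eventually_lt_const
        (by rw [h.map_zero]; exact one_pos))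
    obtain ⟨v, hv1, hv⟩ := (hev.and self_mem_nhdsWithin).exists
    -- Young's inequality at v and 2 / v reads 2 ≤ φ v + ψ(2 / v), while φ v < 1.
    refine ⟨2 / v, ?_⟩
    by_contra! hle
    have h2 := mul_le_add_complementary φ v (2 / v)
    rw [mul_div_cancel₀ _ (ne_of_gt hv)] at h2
    have h3 : φ v + complementary φ (2 / v) < 1 + 1 :=
      ENNReal.add_lt_add_of_lt_of_le (hle.trans_lt ENNReal.one_lt_top).ne hv1 hle
    rw [one_add_one_eq_two] at h3
    exact absurd h2 (not_le.2 (by simpa using h3))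

end Young

/-! ### Luxemburg norm against modular -/

section Luxemburg

variable {H : Type*} [NormedAddCommGroup H] [InnerProductSpace ℂ H] [CompleteSpace H]
variable {ι : Type*} {x : H →L[ℂ] H} {b : HilbertBasis ι ℂ H} {a : ι → ℝ≥0} {f : ℝ≥0 → ℝ≥0∞}

theorem IsEigenbasis.modular_smul (h : IsEigenbasis x b a) (hx : IsCompactOperator x)
    (hf : IsYoungFunction f) (c : ℝ≥0) :
    modular f (((c : ℝ) : ℂ) • x) = ∑' i, f (c * a i) :=
  (h.smul c).modular_eq (hx.smul ((c : ℝ) : ℂ)) hf.mono hf.lsc hf.map_zero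

theorem modular_mul_smul_le (hf : IsYoungFunction f) (hx : IsCompactOperator x) {t : ℝ≥0}
    (ht : t ≤ 1) (c : ℝ≥0) :
    modular f ((((t * c : ℝ≥0) : ℝ) : ℂ) • x) ≤ t * modular f (((c : ℝ) : ℂ) • x) := by
  obtain ⟨ι, b, a, h⟩ := exists_isEigenbasis hx
  rw [h.modular_smul hx hf, h.modular_smul hx hf, ← ENNReal.tsum_mul_left]
  refine ENNReal.tsum_le_tsum fun i => ?_
  rw [mul_assoc]
  exact hf.map_mul_le _ _ ht

theorem isClosed_modular_smul_le_one (hf : IsYoungFunction f) (hx : IsCompactOperator x) :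
    IsClosed {c : ℝ≥0 | modular f (((c : ℝ) : ℂ) • x) ≤ 1} := by
  obtain ⟨ι, b, a, h⟩ := exists_isEigenbasis hx
  simp_rw [h.modular_smul hx hf]
  have hl : LowerSemicontinuous fun c : ℝ≥0 => ∑' i, f (c * a i) :=
    lowerSemicontinuous_tsum fun i =>
      hf.lsc.comp (continuous_id.mul continuous_const)
  exact hl.isClosed_preimage 1

theorem exists_modular_smul_le_one (hf : IsYoungFunction f) (hx : x ∈ orliczSpace f) :
    ∃ c : ℝ≥0, 0 < c ∧ modular f (((c : ℝ) : ℂ) • x) ≤ 1 := by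
  obtain ⟨hxc, l, hl, hfin⟩ := hx
  lift l to ℝ≥0 using hl.le
  obtain ⟨t, ht0, ht1, ht⟩ : ∃ t : ℝ≥0, 0 < t ∧ t ≤ 1 ∧ t * modular f (((l : ℝ) : ℂ) • x) ≤ 1 := by
    lift modular f (((l : ℝ) : ℂ) • x) to ℝ≥0 using hfin.ne with m
    -- The added 1 covers m = 0 and keeps the factor at most 1.
    refine ⟨(m + 1)⁻¹, by positivity, inv_le_one_of_one_le₀ (by simp), ?_⟩
    have : (m + 1)⁻¹ * m ≤ 1 := by
      rw [inv_mul_le_iff₀ (by positivity), mul_one]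
      simp
    exact_mod_cast this
  exact ⟨t * l, mul_pos ht0 (by exact_mod_cast hl), (modular_mul_smul_le hf hxc ht1 l).trans ht⟩

theorem luxemburgNorm_le {l : ℝ} (hl : 0 < l) (h : modular f ((l : ℂ)⁻¹ • x) ≤ 1) :
    luxemburgNorm f x ≤ l :=
  csInf_le ⟨0, fun _ h => h.1.le⟩ ⟨hl, h⟩

theorem luxemburgNorm_set_nonempty (hf : IsYoungFunction f) (hx : x ∈ orliczSpace f) :
    {l : ℝ | 0 < l ∧ modular f ((l : ℂ)⁻¹ • x) ≤ 1}.Nonempty := by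
  obtain ⟨c, hc, h⟩ := exists_modular_smul_le_one hf hx
  refine ⟨(c : ℝ)⁻¹, by positivity, ?_⟩
  simpa using h

/-- Take an eigenvalue a_i > 0 and v with f v > 1: any admissible l has f(a_i / l) ≤ 1, hence l ≥
a_i / v. -/
theorem luxemburgNorm_pos (hf : IsYoungFunction f) (hx : x ∈ orliczSpace f) (hx0 : x ≠ 0) :
    0 < luxemburgNorm f x := by
  obtain ⟨ι, b, a, h⟩ := exists_isEigenbasis hx.1
  obtain ⟨i, hi⟩ : ∃ i, a i ≠ 0 := by
    by_contra! hz
    refine hx0 ?_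
    rw [← CFC.abs_eq_zero_iff]
    ext v
    rw [← (b.hasSum_repr ((CFC.abs x : H →L[ℂ] H) v)).tsum_eq]
    simp [b.repr_apply_apply, h.inner_apply, hz]
  obtain ⟨v, hv⟩ := hf.exists_one_lt
  have hv0 : 0 < v := pos_iff_ne_zero.2 fun hz => by simp [hz, hf.map_zero] at hv
  have hai : 0 < a i := pos_iff_ne_zero.2 hi
  refine lt_of_lt_of_le (a := 0) (b := (a i / v : ℝ)) (by positivity)
    (le_csInf (luxemburgNorm_set_nonempty hf hx) ?_)
  rintro l ⟨hl, hle⟩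
  lift l to ℝ≥0 using hl.le
  rw [show (((l : ℝ) : ℂ))⁻¹ = (((l⁻¹ : ℝ≥0) : ℝ) : ℂ) by simp, h.modular_smul hx.1 hf] at hle
  have h1 : f (l⁻¹ * a i) ≤ 1 := (ENNReal.le_tsum i).trans hle
  have h2 : l⁻¹ * a i ≤ v := by
    by_contra! hlt
    exact absurd h1 (not_le.2 (hv.trans_le (hf.mono hlt.le)))
  have hl' : 0 < l := by exact_mod_cast hl
  rw [inv_mul_le_iff₀ hl'] at h2
  have : a i / v ≤ l := div_le_of_le_mul₀ zero_le zero_le h2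
  exact_mod_cast this

/-- The inverses of a minimizing sequence converge because the norm is positive, and the admissible
scalings form a closed set. -/
theorem modular_inv_luxemburgNorm_le_one (hf : IsYoungFunction f) (hx : x ∈ orliczSpace f)
    (hx0 : x ≠ 0) : modular f ((luxemburgNorm f x : ℂ)⁻¹ • x) ≤ 1 := by
  have hpos := luxemburgNorm_pos hf hx hx0
  obtain ⟨u, -, hu, hmem⟩ := exists_seq_tendsto_sInf (luxemburgNorm_set_nonempty hf hx)
    ⟨0, fun _ h => h.1.le⟩
  have hlim : Tendsto (fun n => (u n)⁻¹.toNNReal) atTop (𝓝 (luxemburgNorm f x)⁻¹.toNNReal) :=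
    (continuous_real_toNNReal.tendsto _).comp (hu.inv₀ hpos.ne')
  have key : ∀ l : ℝ, 0 < l → (((l⁻¹.toNNReal : ℝ≥0) : ℝ) : ℂ) = (l : ℂ)⁻¹ := fun l hl => by
    rw [Real.coe_toNNReal _ (inv_pos.2 hl).le, Complex.ofReal_inv]
  have := (isClosed_modular_smul_le_one hf hx.1).mem_of_tendsto hlim
    (Eventually.of_forall fun n => by
      change modular f _ ≤ 1
      rw [key _ (hmem n).1]; exact (hmem n).2)
  rw [← key _ hpos]
  exact this

theorem modular_le_luxemburgNorm (hf : IsYoungFunction f) (hx : x ∈ orliczSpace f)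
    (h1 : luxemburgNorm f x ≤ 1) : modular f x ≤ ENNReal.ofReal (luxemburgNorm f x) := by
  by_cases hx0 : x = 0
  · obtain ⟨ι, b, a, h⟩ := exists_isEigenbasis hx.1
    have := h.modular_smul hx.1 hf 0
    rw [hx0] at this ⊢
    simp only [zero_mul, hf.map_zero, tsum_zero, smul_zero] at this
    simp [this]
  · have hpos := luxemburgNorm_pos hf hx hx0
    have hle := modular_inv_luxemburgNorm_le_one hf hx hx0
    generalize luxemburgNorm f x = L at *
    lift L to ℝ≥0 using hpos.le
    have hL : L ≠ 0 := by
      rintro rfl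
      simp at hpos
    have h2 := modular_mul_smul_le hf hx.1 (by exact_mod_cast h1 : L ≤ 1) L⁻¹
    rw [mul_inv_cancel₀ hL] at h2
    simp only [NNReal.coe_one, Complex.ofReal_one, one_smul, NNReal.coe_inv,
      Complex.ofReal_inv] at h2
    rw [ENNReal.ofReal_coe_nnreal]
    exact h2.trans (mul_le_of_le_one_right' hle)

theorem luxemburgNorm_le_modular (hf : IsYoungFunction f) (hx : x ∈ orliczSpace f)
    (h1 : 1 < luxemburgNorm f x) : ENNReal.ofReal (luxemburgNorm f x) ≤ modular f x := by
  by_contra! hlt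
  have hne := (hlt.trans ENNReal.ofReal_lt_top).ne
  -- Such an l, above both 1 and the modular, satisfies Tr f(x / l) ≤ Tr f(x) / l ≤ 1, so it is
  -- admissible yet below the infimum.
  obtain ⟨l, hl, hlL⟩ := exists_between (max_lt h1 ((ENNReal.lt_ofReal_iff_toReal_lt hne).1 hlt))
  have hl1 : 1 < l := (le_max_left _ _).trans_lt hl
  have hlm := (le_max_right _ _).trans_lt hl
  lift l to ℝ≥0 using (zero_lt_one.trans hl1).le
  have hl0 : 0 < l := by exact_mod_cast zero_lt_one.trans hl1
  refine absurd hlL (not_lt.2 (luxemburgNorm_le (by exact_mod_cast hl0) ?_))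
  have h2 := modular_mul_smul_le hf hx.1 (inv_le_one_of_one_le₀ (by exact_mod_cast hl1.le) : l⁻¹ ≤ 1) 1
  simp only [mul_one, NNReal.coe_one, Complex.ofReal_one, one_smul, NNReal.coe_inv,
      Complex.ofReal_inv] at h2
  refine h2.trans ?_
  have h3 : modular f x ≤ l := by
    rw [← ENNReal.ofReal_coe_nnreal]
    exact ENNReal.le_ofReal_iff_toReal_le hne l.2 |>.2 hlm.le
  calc ((l⁻¹ : ℝ≥0) : ℝ≥0∞) * modular f x ≤ ((l⁻¹ : ℝ≥0) : ℝ≥0∞) * l := by gcongr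
    _ = 1 := by rw [← ENNReal.coe_mul, inv_mul_cancel₀ hl0.ne', ENNReal.coe_one]

end Luxemburg

/-! ### Hölder inequality and products in the trace class -/

section Holder

variable {H : Type*} [NormedAddCommGroup H] [InnerProductSpace ℂ H] [CompleteSpace H]
variable {x y : H →L[ℂ] H} {f g : ℝ≥0 → ℝ≥0∞}

/-- A Young-type trace inequality for the modulars of a pair with `u v ≤ f u + g v`. -/
theorem mul_posTrace_abs_mul_le (hf : IsYoungFunction f) (hg : IsYoungFunction g)
    (hfg : ∀ u v : ℝ≥0, ((u * v : ℝ≥0) : ℝ≥0∞) ≤ f u + g v) (hx : IsCompactOperator x)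
    (hy : IsCompactOperator y) (l m : ℝ≥0) :
    ((l * m : ℝ≥0) : ℝ≥0∞) * posTrace (CFC.abs (x * y)) ≤
      modular f (((l : ℝ) : ℂ) • x) + modular g (((m : ℝ) : ℂ) • y) := by
  obtain ⟨ι, b, a, hb⟩ := exists_isEigenbasis hx
  obtain ⟨κ, c, d, hc⟩ := exists_isEigenbasis hy
  rw [hb.modular_smul hx hf, hc.modular_smul hy hg]
  have h := posTrace_abs_mul_le (hb.smul l) (hc.smul m) fun i j => hfg (l * a i) (m * d j)
  rwa [smul_mul_smul_comm, ← Complex.ofReal_mul, ← NNReal.coe_mul, posTrace_abs_smul] at h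

theorem mul_mem_traceClass (hf : IsYoungFunction f) (hg : IsYoungFunction g)
    (hfg : ∀ u v : ℝ≥0, ((u * v : ℝ≥0) : ℝ≥0∞) ≤ f u + g v) (hx : x ∈ orliczSpace f)
    (hy : y ∈ orliczSpace g) : x * y ∈ traceClass := by
  obtain ⟨l, hl, hlx⟩ := exists_modular_smul_le_one hf hx
  obtain ⟨m, hm, hmy⟩ := exists_modular_smul_le_one hg hy
  refine mem_traceClass_of_posTrace_ne_top (hx.1.comp_clm y) fun htop => ?_
  have h := mul_posTrace_abs_mul_le hf hg hfg hx.1 hy.1 l m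
  rw [htop, ENNReal.mul_top (by exact_mod_cast (mul_pos hl hm).ne'), top_le_iff,
    ENNReal.add_eq_top] at h
  rcases h with h | h
  · rw [h] at hlx; simp at hlx
  · rw [h] at hmy; simp at hmy

/-- If Tr φ(l x) ≤ 1, every admissible y gives l Tr |xy| ≤ 1 + 1, so 2 / l bounds the supremum. -/
theorem orliczNorm_lt_top {φ : ℝ≥0 → ℝ≥0∞} (hφ : IsOrliczFunction φ) (hx : x ∈ orliczSpace φ) :
    orliczNorm φ x < ∞ := by
  obtain ⟨l, hl, hlx⟩ := exists_modular_smul_le_one hφ.isYoungFunction hx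
  have hl0 : (l : ℝ≥0∞) ≠ 0 := by exact_mod_cast hl.ne'
  refine lt_of_le_of_lt (b := (2 : ℝ≥0∞) / l) (iSup₂_le fun y hy => ?_)
    (ENNReal.div_lt_top ENNReal.ofNat_ne_top hl0)
  rw [ENNReal.le_div_iff_mul_le (Or.inl hl0) (Or.inl ENNReal.coe_ne_top), mul_comm]
  have h := mul_posTrace_abs_mul_le hφ.isYoungFunction hφ.isYoungFunction_complementary
    (mul_le_add_complementary φ) hx.1 hy.1 l 1
  rw [mul_one, NNReal.coe_one, Complex.ofReal_one, one_smul] at h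
  refine h.trans ?_
  rw [← one_add_one_eq_two]
  exact add_le_add hlx hy.2

theorem posTrace_abs_mul_le_orliczNorm_mul_luxemburgNorm {φ : ℝ≥0 → ℝ≥0∞}
    (hφ : IsOrliczFunction φ) (x : H →L[ℂ] H) (hy : y ∈ orliczSpace (complementary φ)) :
    posTrace (CFC.abs (x * y)) ≤
      orliczNorm φ x * ENNReal.ofReal (luxemburgNorm (complementary φ) y) := by
  by_cases hy0 : y = 0
  · have h := posTrace_abs_smul 0 (x * y)
    simp only [hy0, mul_zero, smul_zero, ENNReal.coe_zero, zero_mul] at h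
    rw [hy0, mul_zero, h]
    exact zero_le
  · have hψ := hφ.isYoungFunction_complementary
    have hpos := luxemburgNorm_pos hψ hy hy0
    have hle := modular_inv_luxemburgNorm_le_one hψ hy hy0
    generalize luxemburgNorm (complementary φ) y = L at *
    lift L to ℝ≥0 using hpos.le
    have hL : ((L : ℝ) : ℂ) ≠ 0 := by exact_mod_cast hpos.ne'
    have h1 : posTrace (CFC.abs (x * (((L : ℝ) : ℂ)⁻¹ • y))) ≤ orliczNorm φ x :=
      le_iSup₂ (f := fun (y : H →L[ℂ] H)
        (_ : y ∈ {y : H →L[ℂ] H | IsCompactOperator y ∧ modular (complementary φ) y ≤ 1}) =>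
          posTrace (CFC.abs (x * y))) _ ⟨hy.1.smul _, hle⟩
    have h2 : x * y = ((L : ℝ) : ℂ) • (x * (((L : ℝ) : ℂ)⁻¹ • y)) := by
      rw [mul_smul_comm, smul_smul, mul_inv_cancel₀ hL, one_smul]
    rw [h2, posTrace_abs_smul, ENNReal.ofReal_coe_nnreal, mul_comm]
    gcongr

end Holder

end NCOrlicz

theorem lemma3p1 {H : Type*} [NormedAddCommGroup H] [InnerProductSpace ℂ H] [CompleteSpace H]
    [TopologicalSpace.SeparableSpace H]
    (φ ψ : ℝ≥0 → ℝ≥0∞) (hφ : IsOrliczFunction φ) (hψ : ψ = complementary φ)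
    (x y : H →L[ℂ] H) (hx : x ∈ orliczSpace φ) (hy : y ∈ orliczSpace ψ) :
    (1 < luxemburgNorm φ x → ENNReal.ofReal (luxemburgNorm φ x) ≤ modular φ x) ∧
    (x ≠ 0 → 0 < luxemburgNorm φ x ∧ modular φ ((luxemburgNorm φ x : ℂ)⁻¹ • x) ≤ 1) ∧
    (luxemburgNorm φ x ≤ 1 → modular φ x ≤ ENNReal.ofReal (luxemburgNorm φ x)) ∧
    (orliczNorm φ x < ∞ ∧
      posTrace (CFC.abs (x * y)) ≤ orliczNorm φ x * ENNReal.ofReal (luxemburgNorm ψ y)) ∧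
    (x * y ∈ traceClass ∧ y * x ∈ traceClass) := by
  subst hψ
  have hf := hφ.isYoungFunction
  have hg := hφ.isYoungFunction_complementary
  refine ⟨luxemburgNorm_le_modular hf hx,
    fun hx0 => ⟨luxemburgNorm_pos hf hx hx0, modular_inv_luxemburgNorm_le_one hf hx hx0⟩,
    modular_le_luxemburgNorm hf hx,
    ⟨orliczNorm_lt_top hφ hx, posTrace_abs_mul_le_orliczNorm_mul_luxemburgNorm hφ x hy⟩,
    mul_mem_traceClass hf hg (mul_le_add_complementary φ) hx hy,
    mul_mem_traceClass hg hf (fun u v => ?_) hy hx⟩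
  -- Young's inequality is symmetric in the pair, so the product in the other order needs no new
  -- argument.
  rw [mul_comm, add_comm]
  exact mul_le_add_complementary φ v u
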